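/- **Theorem.** Let $t,n$ be positive integers with $t<n$ and $t\mid n$, and let $f\colon\{0,1\}^t\to\{-1,+1\}$. Partition $\{1,\dots,n\}$ into $t$ contiguous blocks of $n/t$ elements each, let $\mathcal V(n,t)$ be the family of sets $V\subseteq\{1,\dots,n\}$ with exactly one element in each block, and for $x\in\{0,1\}^n$ and $V=\{i_1<\dots<i_t\}\in\mathcal V(n,t)$ put $x|_V=(x_{i_1},\dots,x_{i_t})$. Let $$F=\big[f(x|_V\oplus w)\big]_{x\in\{0,1\}^n,\ (V,w)\in\mathcal V(n,t)\times\{0,1\}^t}$$ be the $(n,t,f)$-pattern matrix. For $\varepsilon\ge 0$ let $\deg_\varepsilon(f)$ be the least degree of a real polynomial $p$ with $|f(z)-p(z)|\le\varepsilon$ for all $z\in\{0,1\}^t$. A *quantum protocol with prior entanglement* for finite input sets $X,Y$ consists of finite sets $W$ and $E\neq\emptyset$, an element $0\in W$, and unitary operators $U_1,\dots,U_{2k}$, where $\mathcal A,\mathcal C,\mathcal B$ are the complex Hilbert spaces with orthonormal bases $X\times W\times E$, $\{|0\rangle,|1\rangle\}$, $Y\times W\times E$; the operators of odd index act on $\mathcal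 A\otimes\mathcal C$ and those of even index on $\mathcal C\otimes\mathcal B$. Its cost is $2k$. On input $(x,y)$ the operators, each tensored with the identity of the remaining factor, are applied in order to the state $|E|^{-1/2}\sum_{e\in E}|x,0,e\rangle|0\rangle|y,0,e\rangle$ of $\mathcal A\otimes\mathcal C\otimes\mathcal B$; the output is $1$ with probability $\langle v,v\rangle$, where $v$ is the projection of the final state onto $\mathcal A\otimes\mathrm{span}(|1\rangle)\otimes\mathcal B$, and $0$ otherwise. The protocol computes a matrix $G\in\{-1,+1\}^{X\times Y}$ with error $\delta$ if for all $x,y$ its output $P(x,y)$ satisfies $G_{x,y}=(-1)^{P(x,y)}$ with probability at least $1-\delta$. Let $Q^*_\delta(G)$ be the least cost of such a protocol ($+\infty$ if there is none). Then for every $\varepsilon\in[0,1)$ and every real $\delta<\varepsilon/2$, $$Q^*_\delta(F)\ \ge\ \frac14\,\deg_\varepsilon(f)\,\log_2\!\Big(\frac nt\Big)-\frac12\,\log_2\!\Big(\frac{3}{\varepsilon-2\delta}\Big).$$ In particular, $$Q^*_{1/7}(F)\ >\ \frac14\,\deg_{1/3}(f)\,\log_2\!\Big(\frac nt\Big)-3.$$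 -/

import Mathlib

open scoped Kronecker Matrix

/-! ### Approximate degree -/

/-- A bit regarded as the real number `0` or `1`. -/
def bitVal (b : Bool) : ℝ := if b then 1 else 0

/-- The `ε`-approximate degree of `f : {0,1}^t → ℝ`: the least `d` for which some real polynomial
of degree at most `d` is within `ε` of `f` at every point of `{0,1}^t`.
(For `ε ≥ 0` such a `d` exists, because every function on `{0,1}^t` is a polynomial.) -/
noncomputable def approxDeg {t : ℕ} (ε : ℝ) (f : (Fin t → Bool) → ℝ) : ℕ :=
  sInf {d : ℕ | ∃ p : MvPolynomial (Fin t) ℝ, p.totalDegree ≤ d ∧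
    ∀ x : Fin t → Bool, |f x - MvPolynomial.eval (fun i => bitVal (x i)) p| ≤ ε}

/-! ### Pattern matrices -/

/-- The `j`-th of the `t` contiguous blocks of `n / t` elements into which `{0, …, n - 1}` is
partitioned (`t ∣ n`). -/
def patternBlock (n t : ℕ) (j : Fin t) : Finset (Fin n) :=
  Finset.univ.filter fun i => (j : ℕ) * (n / t) ≤ i ∧ (i : ℕ) < (j + 1) * (n / t)

/-- The family `𝒱(n,t)` of sets with exactly one element in each block. -/
abbrev PatternSet (n t : ℕ) : Type :=
  {V : Finset (Fin n) // ∀ j : Fin t, (V ∩ patternBlock n t j).card = 1}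

/-- The members of `𝒱(n,t)` have `t` elements. -/
theorem PatternSet.card_eq {n t : ℕ} (h : t ∣ n) (V : PatternSet n t) : V.1.card = t := by
  obtain ⟨m, rfl⟩ := h
  rcases Nat.eq_zero_or_pos t with rfl | ht
  · have : V.1 = ∅ := by
      ext i
      exact absurd i.2 (by simp)
    simp [this]
  have hm : t * m / t = m := Nat.mul_div_cancel_left m ht
  have hlt : ∀ i : Fin (t * m), (i : ℕ) / m < t := fun i =>
    Nat.div_lt_of_lt_mul (i.2.trans_eq (mul_comm t m))
  have key := Finset.card_eq_sum_card_fiberwise (s := V.1) (t := (Finset.univ : Finset (Fin t)))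
    (f := fun i : Fin (t * m) => (⟨(i : ℕ) / m, hlt i⟩ : Fin t)) (fun _ _ => Finset.mem_coe.2 (Finset.mem_univ _))
  rw [key, Finset.sum_congr rfl (g := fun _ => 1)]
  · simp
  · intro j _
    refine (congrArg Finset.card ?_).trans (V.2 j)
    ext i
    have hmpos : 0 < m := by
      rcases Nat.eq_zero_or_pos m with rfl | h
      · exact absurd i.2 (by simp)
      · exact h
    simp only [Finset.mem_filter, Finset.mem_inter, patternBlock, Finset.mem_univ, true_and, hm,
      Fin.ext_iff, Nat.div_eq_iff hmpos]
    constructor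
    · rintro ⟨h1, h2, h3⟩
      refine ⟨h1, h2, ?_⟩
      rw [add_mul, one_mul]
      omega
    · rintro ⟨h1, h2, h3⟩
      rw [add_mul, one_mul] at h3
      exact ⟨h1, h2, by omega⟩

/-- The projection `x|_V = (x_{i_1}, …, x_{i_t})`, where `i_1 < ⋯ < i_t` are the elements
of `V`. -/
def PatternSet.proj {n t : ℕ} (h : t ∣ n) (x : Fin n → Bool) (V : PatternSet n t) : Fin t → Bool :=
  fun j => x (V.1.orderEmbOfFin (V.card_eq h) j)

/-- The `(n,t,φ)`-pattern matrix `[φ(x|_V ⊕ w)]_{x, (V,w)}`. -/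
def patternMatrix (n t : ℕ) (h : t ∣ n) (φ : (Fin t → Bool) → ℝ) :
    Matrix (Fin n → Bool) (PatternSet n t × (Fin t → Bool)) ℝ :=
  Matrix.of fun x Vw => φ fun j => xor (PatternSet.proj h x Vw.1 j) (Vw.2 j)

/-! ### Quantum communication with prior entanglement

The space of a party with inputs from `X`, private workspace `W` and entangled register `E` has
the orthonormal basis `X × W × E`; the channel is a single qubit, with basis `Fin 2`.  A vector of
the tensor product `𝒜 ⊗ 𝒞 ⊗ ℬ` is given by its coordinates in the product basis. -/

/-- The operator `U ⊗ I` on `𝒜 ⊗ 𝒞 ⊗ ℬ`, where `U` acts on `𝒜 ⊗ 𝒞`. -/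
def aliceOp {α : Type*} (β : Type*) [DecidableEq β]
    (U : Matrix (α × Fin 2) (α × Fin 2) ℂ) :
    Matrix (α × Fin 2 × β) (α × Fin 2 × β) ℂ :=
  Matrix.reindex (Equiv.prodAssoc α (Fin 2) β) (Equiv.prodAssoc α (Fin 2) β)
    (U ⊗ₖ (1 : Matrix β β ℂ))

/-- The operator `I ⊗ U` on `𝒜 ⊗ 𝒞 ⊗ ℬ`, where `U` acts on `𝒞 ⊗ ℬ`. -/
def bobOp (α : Type*) {β : Type*} [DecidableEq α]
    (U : Matrix (Fin 2 × β) (Fin 2 × β) ℂ) :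
    Matrix (α × Fin 2 × β) (α × Fin 2 × β) ℂ :=
  (1 : Matrix α α ℂ) ⊗ₖ U

/-- A quantum communication protocol with prior entanglement, input sets `X` and `Y`, private
workspace `W` and entanglement register `E`.  The list holds the pairs
`(U₁, U₂), (U₃, U₄), …, (U_{2k-1}, U_{2k})` of unitary transformations of Alice and Bob, in the
order in which they are applied; `w₀` is the initial content of the workspaces. -/
structure EntangledProtocol (X Y W E : Type) [Fintype X] [DecidableEq X] [Fintype Y] [DecidableEq Y]
    [Fintype W] [DecidableEq W] [Fintype E] [DecidableEq E] where
  w₀ : W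
  rounds : List (Matrix.unitaryGroup ((X × W × E) × Fin 2) ℂ ×
    Matrix.unitaryGroup (Fin 2 × (Y × W × E)) ℂ)

namespace EntangledProtocol

variable {X Y W E : Type} [Fintype X] [DecidableEq X] [Fintype Y] [DecidableEq Y]
  [Fintype W] [DecidableEq W] [Fintype E] [DecidableEq E]

/-- The cost of a protocol: the number `2k` of unitary transformations, each of which sends the
channel qubit once. -/
def cost (P : EntangledProtocol X Y W E) : ℕ := 2 * P.rounds.length

/-- The initial state `|E|^{-1/2} ∑ₑ |x,w₀,e⟩ |0⟩ |y,w₀,e⟩`. -/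
noncomputable def init (P : EntangledProtocol X Y W E) (x : X) (y : Y) :
    (X × W × E) × Fin 2 × (Y × W × E) → ℂ :=
  ((1 / Real.sqrt (Fintype.card E) : ℝ) : ℂ) •
    ∑ e : E, Pi.single ((x, P.w₀, e), (0 : Fin 2), (y, P.w₀, e)) (1 : ℂ)

/-- The state reached after all the unitary transformations. -/
noncomputable def final (P : EntangledProtocol X Y W E) (x : X) (y : Y) :
    (X × W × E) × Fin 2 × (Y × W × E) → ℂ :=
  P.rounds.foldl
    (fun ψ U => bobOp (X × W × E) U.2.1 *ᵥ (aliceOp (Y × W × E) U.1.1 *ᵥ ψ)) (P.init x y)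

/-- The probability of the output `1`: the squared norm of the projection of the final state onto
`𝒜 ⊗ span |1⟩ ⊗ ℬ`. -/
noncomputable def acceptProb (P : EntangledProtocol X Y W E) (x : X) (y : Y) : ℝ :=
  ∑ a : X × W × E, ∑ b : Y × W × E, ‖P.final x y (a, 1, b)‖ ^ 2

/-- The probability of the output `z ∈ {0,1}`. -/
noncomputable def outputProb (P : EntangledProtocol X Y W E) (x : X) (y : Y) (z : Fin 2) : ℝ :=
  if z = 1 then P.acceptProb x y else 1 - P.acceptProb x y

open Classical in
/-- `P` computes `F` with error `δ`: for all `x, y`, the output `z` satisfies `F x y = (-1)^z`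
with probability at least `1 - δ`. -/
def Computes (P : EntangledProtocol X Y W E) (F : Matrix X Y ℝ) (δ : ℝ) : Prop :=
  ∀ x y, 1 - δ ≤ ∑ z : Fin 2, if F x y = (-1) ^ (z : ℕ) then P.outputProb x y z else 0

end EntangledProtocol

/-- `Q*_δ(F)`: the least cost of a quantum protocol with prior entanglement that computes the
matrix `F` with error `δ`, over all finite workspaces and all finite (nonempty) entanglement
registers; it is `⊤` if there is no such protocol. -/
noncomputable def entangledQuantumCC {X Y : Type} [Fintype X] [DecidableEq X]
    [Fintype Y] [DecidableEq Y] (δ : ℝ) (F : Matrix X Y ℝ) : ℕ∞ :=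
  sInf {c : ℕ∞ | ∃ (W E : Type) (_ : Fintype W) (_ : DecidableEq W) (_ : Fintype E)
    (_ : DecidableEq E) (_ : Nonempty E) (P : EntangledProtocol X Y W E),
    P.Computes F δ ∧ c = P.cost}

/-! The proof is the generalized discrepancy method. Let d = deg_ε(f), m = n/t and G = |𝒱(n,t)|.
Separating the sup-norm ball of radius ε around `f` from the span of the characters of order below d
gives a dual witness ψ with ‖ψ‖₁ = 1, ⟨f,ψ⟩ > ε and no Fourier mass below level d
(`exists_dual_of_approxDeg`).

Let Ψ be the pattern matrix of ψ. Since ψ(x|_V ⊕ w) = ∑_S ψ̂(S) χ_{V(S)}(x) χ_S(w), where V(S)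
consists of the elements of V in the blocks indexed by S, Parseval on both sides reduces the
spectral norm of Ψ to counting the pairs (S,V) with |S| ≥ d and V(S) = T. There are at most m^(t-d)
of them, and |ψ̂(S)| ≤ 2^(-t), so ‖Ψ‖² ≤ 2^(n-t) m^(t-d) (`spectralSqLE_patternMatrix`).

On the quantum side, each unitary doubles the number of product terms in the state, so cost c gives
2^c terms. The matrix Π of acceptance probabilities then factors through Gram matrices whose
Frobenius norms cancel the normalization |E|^(-1/2). Hence |⟨M,Π⟩| ≤ 4^c ‖M‖ √(|X||Y|) for every M,
whatever the size of the entanglement (`sum_mul_acceptProb_sq_le`).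

A protocol with error δ has |F - (J - 2Π)| ≤ 2δ entrywise, J being the all-ones matrix. Pairing with
Ψ, where ⟨F,Ψ⟩ > ε‖Ψ‖₁ and ‖Ψ‖₁ = 2^n G, yields (ε - 2δ) 2^n G ≤ 3·4^c ‖Ψ‖ √(|X||Y|). This
simplifies to m^d (ε - 2δ)² ≤ 9·16^c (`pow_mul_sq_le_of_computes`), and logarithms finish the proof.
-/

/-! ### Fourier analysis on the Boolean cube -/

/-- A bit regarded as the sign `1` or `-1`. -/
def boolSign (b : Bool) : ℝ := if b then -1 else 1

theorem boolSign_xor (a b : Bool) : boolSign (xor a b) = boolSign a * boolSign b := by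
  cases a <;> cases b <;> simp [boolSign]

theorem abs_boolSign (a : Bool) : |boolSign a| = 1 := by
  cases a <;> simp [boolSign]

theorem boolSign_eq_one_sub (b : Bool) : boolSign b = 1 - 2 * bitVal b := by
  cases b <;> norm_num [boolSign, bitVal]

/-- The character of the Boolean cube `{0,1}^ι` indexed by `S`. -/
def walsh {ι : Type*} (S : Finset ι) (x : ι → Bool) : ℝ := ∏ i ∈ S, boolSign (x i)

theorem abs_walsh {ι : Type*} (S : Finset ι) (x : ι → Bool) : |walsh S x| = 1 := by
  simp [walsh, Finset.abs_prod, abs_boolSign]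

theorem walsh_xor {ι : Type*} (S : Finset ι) (x y : ι → Bool) :
    walsh S (fun i => xor (x i) (y i)) = walsh S x * walsh S y := by
  simp [walsh, boolSign_xor, Finset.prod_mul_distrib]

theorem walsh_comp {ι κ : Type*} [DecidableEq κ] (S : Finset ι) {g : ι → κ}
    (hg : Function.Injective g) (x : κ → Bool) :
    walsh S (fun i => x (g i)) = walsh (S.image g) x := by
  simp [walsh, Finset.prod_image (fun a _ b _ h => hg h)]

/-- The sum over all S is the expanded form of a product over coordinates, whose factor is 2 where x
and y agree and 0 where they differ. -/
theorem sum_walsh_mul_walsh {ι : Type*} [Fintype ι] [DecidableEq ι] (x y : ι → Bool) :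
    ∑ S : Finset ι, walsh S x * walsh S y = if x = y then (2 : ℝ) ^ Fintype.card ι else 0 := by
  have h : ∑ S : Finset ι, walsh S x * walsh S y = ∏ i, (1 + boolSign (x i) * boolSign (y i)) := by
    rw [Finset.prod_one_add, Finset.powerset_univ]
    simp [walsh, Finset.prod_mul_distrib]
  rw [h]
  split_ifs with hxy
  · subst hxy
    rw [Finset.prod_congr rfl (g := fun _ => (2 : ℝ))]
    · simp
    · intro i _
      cases x i <;> norm_num [boolSign]
  · obtain ⟨i, hi⟩ := Function.ne_iff.1 hxy
    refine Finset.prod_eq_zero (Finset.mem_univ i) ?_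
    revert hi
    cases x i <;> cases y i <;> norm_num [boolSign]

theorem sum_norm_sq_fourier {ι : Type*} [Fintype ι] [DecidableEq ι] (u : (ι → Bool) → ℂ) :
    ∑ S : Finset ι, ‖∑ x, u x * (walsh S x : ℂ)‖ ^ 2 =
      2 ^ Fintype.card ι * ∑ x, ‖u x‖ ^ 2 := by
  have key : ∀ x y : ι → Bool, ∑ S : Finset ι, (walsh S x : ℂ) * (walsh S y : ℂ) =
      if x = y then (2 : ℂ) ^ Fintype.card ι else 0 := by
    intro x y
    have := congrArg (fun r : ℝ => (r : ℂ)) (sum_walsh_mul_walsh x y)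
    split_ifs at this ⊢ <;> simpa using this
  apply Complex.ofReal_injective
  push_cast
  simp_rw [← Complex.conj_mul', map_sum, map_mul, Complex.conj_ofReal, Finset.sum_mul_sum]
  rw [Finset.sum_comm, Finset.mul_sum]
  refine Finset.sum_congr rfl fun x _ => ?_
  rw [Finset.sum_comm]
  have : ∀ y, ∑ S : Finset ι, (starRingEnd ℂ) (u x) * (walsh S x : ℂ) * (u y * (walsh S y : ℂ)) =
      (starRingEnd ℂ) (u x) * u y * if x = y then (2 : ℂ) ^ Fintype.card ι else 0 := by
    intro y
    rw [← key, Finset.mul_sum]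
    exact Finset.sum_congr rfl fun S _ => by ring
  simp [this]
  ring

/-- The Fourier coefficient of a function on the Boolean cube. -/
noncomputable def walshCoeff {ι : Type*} [Fintype ι] [DecidableEq ι] (φ : (ι → Bool) → ℝ)
    (S : Finset ι) : ℝ :=
  (2 ^ Fintype.card ι)⁻¹ * ∑ x, φ x * walsh S x

theorem sum_walshCoeff_mul_walsh {ι : Type*} [Fintype ι] [DecidableEq ι]
    (φ : (ι → Bool) → ℝ) (z : ι → Bool) : ∑ S, walshCoeff φ S * walsh S z = φ z := by
  simp_rw [walshCoeff, mul_assoc, Finset.sum_mul, ← Finset.mul_sum]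
  rw [Finset.sum_comm]
  simp_rw [mul_assoc, ← Finset.mul_sum, sum_walsh_mul_walsh]
  simp
  field_simp

theorem abs_walshCoeff_le {ι : Type*} [Fintype ι] [DecidableEq ι] (φ : (ι → Bool) → ℝ)
    (S : Finset ι) : |walshCoeff φ S| ≤ (2 ^ Fintype.card ι)⁻¹ * ∑ x, |φ x| := by
  rw [walshCoeff, abs_mul, abs_of_pos (by positivity : (0 : ℝ) < (2 ^ Fintype.card ι)⁻¹)]
  gcongr
  refine (Finset.abs_sum_le_sum_abs _ _).trans (Finset.sum_le_sum fun x _ => ?_)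
  rw [abs_mul, abs_walsh, mul_one]

/-! ### Spectral bounds -/

theorem norm_sum_sq_le_of_sq_le_mul {ι : Type*} (s : Finset ι) (z : ι → ℂ) {p q : ι → ℝ}
    (hp : ∀ i ∈ s, 0 ≤ p i) (hq : ∀ i ∈ s, 0 ≤ q i) (h : ∀ i ∈ s, ‖z i‖ ^ 2 ≤ p i * q i) :
    ‖∑ i ∈ s, z i‖ ^ 2 ≤ (∑ i ∈ s, p i) * ∑ i ∈ s, q i :=
  (pow_le_pow_left₀ (norm_nonneg _) (norm_sum_le _ _) 2).trans
    (Finset.sum_sq_le_sum_mul_sum_of_sq_le_mul s hp hq h)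

/-- The square of the spectral norm of `M` is at most `L`. -/
def SpectralSqLE {X Y : Type*} [Fintype X] [Fintype Y] (M : Matrix X Y ℝ) (L : ℝ) : Prop :=
  ∀ (u : X → ℂ) (v : Y → ℂ), ‖∑ x, ∑ y, (M x y : ℂ) * (u x * v y)‖ ^ 2 ≤
    L * (∑ x, ‖u x‖ ^ 2) * ∑ y, ‖v y‖ ^ 2

theorem SpectralSqLE.sum_sq_le {X Y : Type*} [Fintype X] [Fintype Y] {M : Matrix X Y ℝ} {L : ℝ}
    (h : SpectralSqLE M L) :
    (∑ x, ∑ y, M x y) ^ 2 ≤ L * Fintype.card X * Fintype.card Y := by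
  have := h (fun _ => 1) (fun _ => 1)
  simp only [mul_one, norm_one, one_pow, Finset.sum_const, Finset.card_univ, nsmul_eq_mul] at this
  rw [← sq_abs, ← Real.norm_eq_abs, ← Complex.norm_real]
  push_cast
  exact this

/-- In Fourier coordinates the bilinear form has one term per pair (S,V). Cauchy–Schwarz separates
the two transforms; the transform of `u` at T is then counted once for each pair sent to T, which is
where the fibre bound `N` enters. -/
theorem spectralSqLE_of_fibre_card_le {ι κ Γ : Type*} [Fintype ι] [DecidableEq ι] [Fintype κ]
    [DecidableEq κ] [Fintype Γ] (sel : Γ → ι → κ)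
    (hsel : ∀ V, Function.Injective (sel V)) (φ : (ι → Bool) → ℝ) (d : ℕ) {c N : ℝ}
    (hφ : ∀ S, S.card < d → walshCoeff φ S = 0)
    (hc0 : 0 ≤ c) (hc : ∀ S, walshCoeff φ S ^ 2 ≤ c)
    (hN : ∀ T : Finset κ, (((Finset.univ : Finset (Finset ι × Γ)).filter fun p =>
      d ≤ p.1.card ∧ p.1.image (sel p.2) = T).card : ℝ) ≤ N) :
    SpectralSqLE (Matrix.of fun (x : κ → Bool) (Vw : Γ × (ι → Bool)) =>
        φ fun j => xor (x (sel Vw.1 j)) (Vw.2 j))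
      (c * N * 2 ^ Fintype.card κ * 2 ^ Fintype.card ι) := by
  intro u v
  set û : Finset κ → ℂ := fun T => ∑ x, u x * (walsh T x : ℂ) with hû
  set vhat : Finset ι × Γ → ℂ := fun p => ∑ w, v (p.2, w) * (walsh p.1 w : ℂ) with hv
  have expand : ∀ x Vw, ((φ fun j => xor (x (sel (Vw : Γ × (ι → Bool)).1 j)) (Vw.2 j) : ℝ) : ℂ) =
      ∑ S, (walshCoeff φ S : ℂ) * (walsh (S.image (sel Vw.1)) x : ℂ) * (walsh S Vw.2 : ℂ) := by
    intro x Vw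
    rw [← sum_walshCoeff_mul_walsh φ]
    push_cast
    refine Finset.sum_congr rfl fun S _ => ?_
    rw [walsh_xor S (fun j => x (sel Vw.1 j)) Vw.2, walsh_comp S (hsel Vw.1) x]
    push_cast
    ring
  have e1 : ∑ x, ∑ y, ((Matrix.of fun (x : κ → Bool) (Vw : Γ × (ι → Bool)) =>
        φ fun j => xor (x (sel Vw.1 j)) (Vw.2 j)) x y : ℂ) * (u x * v y) =
      ∑ p : Finset ι × Γ, (walshCoeff φ p.1 : ℂ) * û (p.1.image (sel p.2)) * vhat p := by
    simp only [Matrix.of_apply, expand, Fintype.sum_prod_type, Finset.sum_mul, hû, hv,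
      Finset.mul_sum]
    calc _ = ∑ x, ∑ V, ∑ S, ∑ w, (walshCoeff φ S : ℂ) * (walsh (S.image (sel V)) x : ℂ) *
          (walsh S w : ℂ) * (u x * v (V, w)) := by
          refine Finset.sum_congr rfl fun x _ => Finset.sum_congr rfl fun V _ => ?_
          rw [Finset.sum_comm]
      _ = ∑ x, ∑ S, ∑ V, ∑ w, (walshCoeff φ S : ℂ) * (walsh (S.image (sel V)) x : ℂ) *
          (walsh S w : ℂ) * (u x * v (V, w)) := by
          refine Finset.sum_congr rfl fun x _ => ?_
          rw [Finset.sum_comm]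
      _ = ∑ S, ∑ V, ∑ x, ∑ w, (walshCoeff φ S : ℂ) * (walsh (S.image (sel V)) x : ℂ) *
          (walsh S w : ℂ) * (u x * v (V, w)) := by
          rw [Finset.sum_comm]
          refine Finset.sum_congr rfl fun S _ => ?_
          rw [Finset.sum_comm]
      _ = _ := by
          refine Finset.sum_congr rfl fun S _ => Finset.sum_congr rfl fun V _ => ?_
          rw [Finset.sum_comm]
          refine Finset.sum_congr rfl fun w _ => Finset.sum_congr rfl fun x _ => ?_
          ring
  -- Parseval in the variable w, separately for each V.
  have e2 : ∑ p, ‖vhat p‖ ^ 2 = 2 ^ Fintype.card ι * ∑ y, ‖v y‖ ^ 2 := by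
    rw [Fintype.sum_prod_type, Finset.sum_comm, Fintype.sum_prod_type, Finset.mul_sum]
    exact Finset.sum_congr rfl fun V _ => sum_norm_sq_fourier fun w => v (V, w)
  have e3 : ∑ p : Finset ι × Γ, walshCoeff φ p.1 ^ 2 * ‖û (p.1.image (sel p.2))‖ ^ 2 ≤
      c * N * (2 ^ Fintype.card κ * ∑ x, ‖u x‖ ^ 2) := by
    calc _ = ∑ p ∈ Finset.univ.filter (fun p : Finset ι × Γ => d ≤ p.1.card),
          walshCoeff φ p.1 ^ 2 * ‖û (p.1.image (sel p.2))‖ ^ 2 := by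
          rw [Finset.sum_filter]
          refine Finset.sum_congr rfl fun p _ => ?_
          split_ifs with h
          · rfl
          · rw [hφ p.1 (not_le.1 h)]; simp
      _ ≤ ∑ p ∈ Finset.univ.filter (fun p : Finset ι × Γ => d ≤ p.1.card),
          c * ‖û (p.1.image (sel p.2))‖ ^ 2 := by
          gcongr with p _
          exact hc _
      _ = ∑ T, ∑ p ∈ (Finset.univ.filter (fun p : Finset ι × Γ => d ≤ p.1.card)).filter
            (fun p => p.1.image (sel p.2) = T), c * ‖û (p.1.image (sel p.2))‖ ^ 2 := by
          rw [Finset.sum_fiberwise]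
      _ = ∑ T, ((Finset.univ.filter fun p : Finset ι × Γ =>
            d ≤ p.1.card ∧ p.1.image (sel p.2) = T).card : ℝ) * (c * ‖û T‖ ^ 2) := by
          refine Finset.sum_congr rfl fun T _ => ?_
          rw [Finset.filter_filter, ← nsmul_eq_mul, ← Finset.sum_const]
          refine Finset.sum_congr rfl fun p hp => ?_
          rw [(Finset.mem_filter.1 hp).2.2]
      _ ≤ ∑ T, N * (c * ‖û T‖ ^ 2) := by
          gcongr with T _
          exact hN T
      _ = _ := by
          rw [← sum_norm_sq_fourier, Finset.mul_sum]
          exact Finset.sum_congr rfl fun T _ => by ring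
  rw [e1]
  refine (norm_sum_sq_le_of_sq_le_mul Finset.univ _
    (p := fun p => walshCoeff φ p.1 ^ 2 * ‖û (p.1.image (sel p.2))‖ ^ 2)
    (q := fun p => ‖vhat p‖ ^ 2) (fun _ _ => by positivity) (fun _ _ => by positivity)
    (fun p _ => ?_)).trans ?_
  · simp [mul_pow]
  · rw [e2]
    refine (mul_le_mul_of_nonneg_right e3 (by positivity)).trans (le_of_eq ?_)
    ring

/-! ### Contractions -/

/-- `M` is a contraction for the Euclidean norms. -/
def IsContraction {α β : Type*} [Fintype α] [Fintype β] (M : Matrix α β ℂ) : Prop :=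
  ∀ v : β → ℂ, ∑ i, ‖(M *ᵥ v) i‖ ^ 2 ≤ ∑ j, ‖v j‖ ^ 2

open scoped Matrix.Norms.L2Operator in
theorem isContraction_iff_norm_le_one {α β : Type*} [Fintype α] [Fintype β] [DecidableEq β]
    (M : Matrix α β ℂ) : IsContraction M ↔ ‖M‖ ≤ 1 := by
  constructor
  · intro h
    rw [Matrix.l2_opNorm_def]
    refine ContinuousLinearMap.opNorm_le_bound _ zero_le_one fun v => ?_
    rw [one_mul]
    refine le_of_sq_le_sq ?_ (norm_nonneg _)
    rw [EuclideanSpace.norm_sq_eq, EuclideanSpace.norm_sq_eq]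
    exact h v.ofLp
  · intro h v
    have h1 := Matrix.l2_opNorm_mulVec M (WithLp.toLp 2 v)
    have h2 := pow_le_pow_left₀ (norm_nonneg _)
      (h1.trans (mul_le_of_le_one_left (norm_nonneg _) h)) 2
    rw [EuclideanSpace.norm_sq_eq, EuclideanSpace.norm_sq_eq] at h2
    exact h2

-- The adjoint is the reason for passing to the operator norm, which it preserves.
open scoped Matrix.Norms.L2Operator in
theorem IsContraction.conjTranspose {α β : Type*} [Fintype α] [Fintype β] [DecidableEq α]
    [DecidableEq β] {M : Matrix α β ℂ} (h : IsContraction M) : IsContraction Mᴴ := by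
  rw [isContraction_iff_norm_le_one] at *
  rwa [Matrix.l2_opNorm_conjTranspose]

theorem IsContraction.mul {α β γ : Type*} [Fintype α] [Fintype β] [Fintype γ]
    {M : Matrix α β ℂ} {N : Matrix β γ ℂ} (hM : IsContraction M) (hN : IsContraction N) :
    IsContraction (M * N) := fun v => by
  rw [← Matrix.mulVec_mulVec]
  exact (hM _).trans (hN v)

theorem isContraction_zero {α β : Type*} [Fintype α] [Fintype β] :
    IsContraction (0 : Matrix α β ℂ) := fun v => by
  simp only [Matrix.zero_mulVec, Pi.zero_apply, norm_zero]
  simp only [ne_eq, OfNat.ofNat_ne_zero, not_false_eq_true, zero_pow, Finset.sum_const_zero]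
  positivity

theorem sum_norm_sq_mulVec_of_conjTranspose_mul_self {α : Type*} [Fintype α] [DecidableEq α]
    {U : Matrix α α ℂ} (hU : Uᴴ * U = 1) (v : α → ℂ) :
    ∑ i, ‖(U *ᵥ v) i‖ ^ 2 = ∑ i, ‖v i‖ ^ 2 := by
  have h : ∀ w : α → ℂ, ((∑ i, ‖w i‖ ^ 2 : ℝ) : ℂ) = star w ⬝ᵥ w := by
    intro w
    push_cast
    simp [dotProduct, Complex.conj_mul']
  apply Complex.ofReal_injective
  rw [h, h, Matrix.star_mulVec, ← Matrix.dotProduct_mulVec, Matrix.mulVec_mulVec, hU,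
    Matrix.one_mulVec]

theorem isContraction_of_injective {α β : Type*} [Fintype α] [Fintype β] [DecidableEq α]
    {g : β → α} (hg : Function.Injective g) :
    IsContraction (Matrix.of fun a e => if a = g e then (1 : ℂ) else 0) := fun v => by
  classical
  have h1 : ∀ e, ((Matrix.of fun a e => if a = g e then (1 : ℂ) else 0) *ᵥ v) (g e) = v e := by
    intro e
    simp [Matrix.mulVec, dotProduct, hg.eq_iff]
  have h2 : ∀ a, a ∉ Finset.univ.image g →
      ‖((Matrix.of fun a e => if a = g e then (1 : ℂ) else 0) *ᵥ v) a‖ ^ 2 = 0 := by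
    intro a ha
    have : ∀ e, a ≠ g e := fun e he => ha (he ▸ Finset.mem_image_of_mem g (Finset.mem_univ e))
    simp [Matrix.mulVec, dotProduct, this]
  rw [← Finset.sum_subset (Finset.subset_univ (Finset.univ.image g)) fun a _ ha => h2 a ha,
    Finset.sum_image fun a _ b _ h => hg h]
  simp [h1]

/-- Taking a submatrix amounts to padding the input with zeros, applying `M` and discarding output
coordinates. -/
theorem isContraction_submatrix {α β γ δ : Type*} [Fintype α] [Fintype β] [Fintype γ] [Fintype δ]
    [DecidableEq α] [DecidableEq β] {M : Matrix α β ℂ} (hM : IsContraction M)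
    {f : γ → α} {g : δ → β} (hf : Function.Injective f) (hg : Function.Injective g) :
    IsContraction (M.submatrix f g) := fun v => by
  classical
  have e : ∀ i, (M.submatrix f g *ᵥ v) i =
      (M *ᵥ ((Matrix.of fun a e => if a = g e then (1 : ℂ) else 0) *ᵥ v)) (f i) := by
    intro i
    rw [Matrix.mulVec_mulVec]
    simp [Matrix.mulVec, dotProduct, Matrix.mul_apply]
  simp_rw [e]
  refine le_trans ?_ ((hM _).trans (isContraction_of_injective hg v))
  rw [← Finset.sum_image (s := Finset.univ) (g := f) (fun a _ b _ h => hf h)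
    (f := fun a => ‖(M *ᵥ ((Matrix.of fun a e => if a = g e then (1 : ℂ) else 0) *ᵥ v)) a‖ ^ 2)]
  exact Finset.sum_le_sum_of_subset_of_nonneg (Finset.subset_univ _) fun _ _ _ => by positivity

/-- Each of the |ε| columns of the product is the image of a unit vector under a contraction, so it
has norm at most 1. -/
theorem IsContraction.sum_norm_sq_conjTranspose_mul_le {α ε : Type*} [Fintype α] [Fintype ε]
    [DecidableEq α] [DecidableEq ε] {V W : Matrix α ε ℂ} (hV : IsContraction V)
    (hW : IsContraction W) :
    ∑ e, ∑ e', ‖(Vᴴ * W) e e'‖ ^ 2 ≤ Fintype.card ε := by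
  rw [Finset.sum_comm]
  have h : ∀ e', ∑ e, ‖(Vᴴ * W) e e'‖ ^ 2 ≤ 1 := by
    intro e'
    have := (hV.conjTranspose.mul hW) (Pi.single e' 1)
    simpa [Pi.single_apply, apply_ite] using this
  refine (Finset.sum_le_sum fun e' _ => h e').trans ?_
  simp

/-! ### Acceptance probabilities of quantum protocols -/

theorem aliceOp_mulVec {α β : Type*} [Fintype α] [Fintype β] [DecidableEq β]
    (U : Matrix (α × Fin 2) (α × Fin 2) ℂ) (ψ : α × Fin 2 × β → ℂ) (a : α) (c : Fin 2) (b : β) :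
    (aliceOp β U *ᵥ ψ) (a, c, b) = ∑ c', ∑ a', U (a, c) (a', c') * ψ (a', c', b) := by
  rw [Finset.sum_comm]
  simp [aliceOp, Matrix.mulVec, dotProduct, Fintype.sum_prod_type, Matrix.one_apply]

theorem bobOp_mulVec {α β : Type*} [Fintype α] [Fintype β] [DecidableEq α]
    (U : Matrix (Fin 2 × β) (Fin 2 × β) ℂ) (ψ : α × Fin 2 × β → ℂ) (a : α) (c : Fin 2) (b : β) :
    (bobOp α U *ᵥ ψ) (a, c, b) = ∑ c', ∑ b', U (c, b) (c', b') * ψ (a, c', b') := by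
  simp [bobOp, Matrix.mulVec, dotProduct, Fintype.sum_prod_type, Matrix.one_apply]

theorem sum_norm_sq_aliceOp_mulVec {α β : Type*} [Fintype α] [Fintype β] [DecidableEq α]
    [DecidableEq β] {U : Matrix (α × Fin 2) (α × Fin 2) ℂ} (hU : Uᴴ * U = 1)
    (ψ : α × Fin 2 × β → ℂ) :
    ∑ i, ‖(aliceOp β U *ᵥ ψ) i‖ ^ 2 = ∑ i, ‖ψ i‖ ^ 2 := by
  refine sum_norm_sq_mulVec_of_conjTranspose_mul_self ?_ ψ
  rw [aliceOp, Matrix.conjTranspose_reindex, Matrix.reindex_apply, Matrix.reindex_apply,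
    Matrix.submatrix_mul_equiv, Matrix.conjTranspose_kronecker, ← Matrix.mul_kronecker_mul, hU]
  simp

theorem sum_norm_sq_bobOp_mulVec {α β : Type*} [Fintype α] [Fintype β] [DecidableEq α]
    [DecidableEq β] {U : Matrix (Fin 2 × β) (Fin 2 × β) ℂ} (hU : Uᴴ * U = 1)
    (ψ : α × Fin 2 × β → ℂ) :
    ∑ i, ‖(bobOp α U *ᵥ ψ) i‖ ^ 2 = ∑ i, ‖ψ i‖ ^ 2 := by
  refine sum_norm_sq_mulVec_of_conjTranspose_mul_self ?_ ψ
  rw [bobOp, Matrix.conjTranspose_kronecker, ← Matrix.mul_kronecker_mul, hU]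
  simp

theorem sum_norm_sq_channel_le {α β : Type*} [Fintype α] [Fintype β] (ψ : α × Fin 2 × β → ℂ)
    (c : Fin 2) : ∑ a, ∑ b, ‖ψ (a, c, b)‖ ^ 2 ≤ ∑ i, ‖ψ i‖ ^ 2 := by
  rw [Fintype.sum_prod_type]
  refine Finset.sum_le_sum fun a _ => ?_
  rw [Fintype.sum_prod_type]
  exact Finset.single_le_sum (f := fun c => ∑ b, ‖ψ (a, c, b)‖ ^ 2)
    (fun c _ => Finset.sum_nonneg fun b _ => sq_nonneg _) (Finset.mem_univ c)

/-- For each content of the channel, the states `ψ x y` are, up to the scalar `r`, sums of `N`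
products of a contraction depending on `x` and one depending on `y`. -/
def HasProductForm {X Y α β : Type} (E : Type) [Fintype α] [Fintype β] [Fintype E] (r : ℂ) (N : ℕ)
    (ψ : X → Y → α × Fin 2 × β → ℂ) : Prop :=
  ∃ (S : Type) (_ : Fintype S) (V : Fin 2 → S → X → Matrix α E ℂ)
    (W : Fin 2 → S → Y → Matrix β E ℂ), Fintype.card S = N ∧
    (∀ c s x, IsContraction (V c s x)) ∧ (∀ c s y, IsContraction (W c s y)) ∧
    ∀ x y a c b, ψ x y (a, c, b) = r * ∑ s, ∑ e, V c s x a e * W c s y b e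

/-- The new terms are indexed by the previous channel content c' together with the old index. The
block of `U` taking c' to c is again a contraction and is absorbed into Alice's factor, leaving
Bob's untouched. -/
theorem HasProductForm.aliceOp {X Y α β E : Type} [Fintype α] [Fintype β] [Fintype E]
    [DecidableEq α] [DecidableEq β] {r : ℂ} {N : ℕ} {ψ : X → Y → α × Fin 2 × β → ℂ}
    (h : HasProductForm E r N ψ) {U : Matrix (α × Fin 2) (α × Fin 2) ℂ} (hU : IsContraction U) :
    HasProductForm E r (2 * N) (fun x y => aliceOp β U *ᵥ ψ x y) := by
  obtain ⟨S, _, V, W, hS, hV, hW, hψ⟩ := h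
  refine ⟨Fin 2 × S, inferInstance,
    fun c p x => U.submatrix (fun a => (a, c)) (fun a => (a, p.1)) * V p.1 p.2 x,
    fun _ p y => W p.1 p.2 y, by simp [hS], fun c p x => ?_, fun _ p y => hW _ _ _, ?_⟩
  · exact (isContraction_submatrix hU (fun a b h => congrArg Prod.fst h)
      (fun a b h => congrArg Prod.fst h)).mul (hV _ _ _)
  · intro x y a c b
    beta_reduce
    rw [aliceOp_mulVec, Fintype.sum_prod_type, Finset.mul_sum]
    refine Finset.sum_congr rfl fun c' _ => ?_
    simp_rw [hψ, Matrix.mul_apply, Matrix.submatrix_apply, Finset.sum_mul, Finset.mul_sum]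
    rw [Finset.sum_comm]
    refine Finset.sum_congr rfl fun s _ => ?_
    rw [Finset.sum_comm]
    refine Finset.sum_congr rfl fun e _ => Finset.sum_congr rfl fun a' _ => ?_
    ring

theorem HasProductForm.bobOp {X Y α β E : Type} [Fintype α] [Fintype β] [Fintype E]
    [DecidableEq α] [DecidableEq β] {r : ℂ} {N : ℕ} {ψ : X → Y → α × Fin 2 × β → ℂ}
    (h : HasProductForm E r N ψ) {U : Matrix (Fin 2 × β) (Fin 2 × β) ℂ} (hU : IsContraction U) :
    HasProductForm E r (2 * N) (fun x y => bobOp α U *ᵥ ψ x y) := by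
  obtain ⟨S, _, V, W, hS, hV, hW, hψ⟩ := h
  refine ⟨Fin 2 × S, inferInstance, fun _ p x => V p.1 p.2 x,
    fun c p y => U.submatrix (fun b => (c, b)) (fun b => (p.1, b)) * W p.1 p.2 y,
    by simp [hS], fun _ p x => hV _ _ _, fun c p y => ?_, ?_⟩
  · exact (isContraction_submatrix hU (fun a b h => congrArg Prod.snd h)
      (fun a b h => congrArg Prod.snd h)).mul (hW _ _ _)
  · intro x y a c b
    beta_reduce
    rw [bobOp_mulVec, Fintype.sum_prod_type, Finset.mul_sum]
    refine Finset.sum_congr rfl fun c' _ => ?_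
    simp_rw [hψ, Matrix.mul_apply, Matrix.submatrix_apply, Finset.mul_sum]
    rw [Finset.sum_comm]
    refine Finset.sum_congr rfl fun s _ => ?_
    rw [Finset.sum_comm]
    refine Finset.sum_congr rfl fun e _ => Finset.sum_congr rfl fun a' _ => ?_
    ring

theorem conjTranspose_mul_self_of_unitaryGroup {α : Type*} [Fintype α] [DecidableEq α]
    (U : Matrix.unitaryGroup α ℂ) : U.1ᴴ * U.1 = 1 :=
  Matrix.mem_unitaryGroup_iff'.1 U.2

theorem isContraction_of_unitaryGroup {α : Type*} [Fintype α] [DecidableEq α]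
    (U : Matrix.unitaryGroup α ℂ) : IsContraction U.1 := fun v =>
  (sum_norm_sq_mulVec_of_conjTranspose_mul_self (conjTranspose_mul_self_of_unitaryGroup U) v).le

/-- The entries of all the Gram matrices `(V s)ᴴ * V s'` of a family of matrices. -/
def gramEntry {S α E : Type*} [Fintype α] (V : S → Matrix α E ℂ) (i : (S × S) × (E × E)) : ℂ :=
  ((V i.1.1)ᴴ * V i.1.2) i.2.1 i.2.2

theorem sum_norm_sq_gramEntry_le {S X α E : Type*} [Fintype S] [Fintype X] [Fintype α] [Fintype E]
    [DecidableEq α] [DecidableEq E] {V : S → X → Matrix α E ℂ}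
    (hV : ∀ s x, IsContraction (V s x)) :
    ∑ i, ∑ x, ‖gramEntry (V · x) i‖ ^ 2 ≤
      (Fintype.card S : ℝ) ^ 2 * Fintype.card E * Fintype.card X := by
  rw [Finset.sum_comm]
  have h : ∀ x, ∑ i, ‖gramEntry (V · x) i‖ ^ 2 ≤ (Fintype.card S : ℝ) ^ 2 * Fintype.card E := by
    intro x
    rw [Fintype.sum_prod_type]
    have h' : ∀ s : S × S, ∑ e : E × E, ‖gramEntry (V · x) (s, e)‖ ^ 2 ≤ Fintype.card E := by
      intro s
      rw [Fintype.sum_prod_type]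
      have := (hV s.1 x).sum_norm_sq_conjTranspose_mul_le (hV s.2 x)
      unfold gramEntry
      exact this
    refine (Finset.sum_le_sum fun s _ => h' s).trans (le_of_eq ?_)
    simp [sq]
  refine (Finset.sum_le_sum fun x _ => h x).trans (le_of_eq ?_)
  simp [mul_comm]

/-- Once the square is expanded, the sums over a and b separate. The result is an inner product of a
vector depending on Alice's matrices alone with one depending on Bob's alone. -/
theorem sum_norm_sq_sum_mul_eq_gramEntry {S α β E : Type*} [Fintype S] [Fintype α] [Fintype β]
    [Fintype E] (V : S → Matrix α E ℂ) (W : S → Matrix β E ℂ) :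
    ((∑ a, ∑ b, ‖∑ s, ∑ e, V s a e * W s b e‖ ^ 2 : ℝ) : ℂ) =
      ∑ i, gramEntry V i * gramEntry W i := by
  have h : ∀ a b, ((‖∑ s, ∑ e, V s a e * W s b e‖ ^ 2 : ℝ) : ℂ) =
      ∑ i : (S × S) × (E × E), (star (V i.1.1 a i.2.1) * V i.1.2 a i.2.2) *
        (star (W i.1.1 b i.2.1) * W i.1.2 b i.2.2) := by
    intro a b
    rw [Complex.ofReal_pow, ← Complex.conj_mul', map_sum, Finset.sum_mul_sum,
      Fintype.sum_prod_type, Fintype.sum_prod_type]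
    refine Finset.sum_congr rfl fun s _ => Finset.sum_congr rfl fun s' _ => ?_
    rw [map_sum, Finset.sum_mul_sum, Fintype.sum_prod_type]
    refine Finset.sum_congr rfl fun e _ => Finset.sum_congr rfl fun e' _ => ?_
    rw [map_mul, ← starRingEnd_apply, ← starRingEnd_apply]
    ring
  simp_rw [Complex.ofReal_sum, h]
  calc _ = ∑ a, ∑ i : (S × S) × (E × E), ∑ b, (star (V i.1.1 a i.2.1) * V i.1.2 a i.2.2) *
        (star (W i.1.1 b i.2.1) * W i.1.2 b i.2.2) :=
        Finset.sum_congr rfl fun a _ => Finset.sum_comm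
    _ = ∑ i : (S × S) × (E × E), ∑ a, ∑ b, (star (V i.1.1 a i.2.1) * V i.1.2 a i.2.2) *
        (star (W i.1.1 b i.2.1) * W i.1.2 b i.2.2) := Finset.sum_comm
    _ = _ := by
        refine Finset.sum_congr rfl fun i _ => ?_
        rw [gramEntry, gramEntry, Matrix.mul_apply, Matrix.mul_apply, Finset.sum_mul_sum]
        rfl

/-- A matrix of small spectral norm correlates weakly with the squared norms of states in product
form. -/
theorem HasProductForm.sum_mul_sq_le {X Y α β E : Type} [Fintype X] [Fintype Y] [Fintype α]
    [Fintype β] [Fintype E] [DecidableEq α] [DecidableEq β] [DecidableEq E] {r : ℝ}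
    (hr : r ^ 2 * Fintype.card E = 1) {N : ℕ} {ψ : X → Y → α × Fin 2 × β → ℂ}
    (h : HasProductForm E r N ψ) (M : Matrix X Y ℝ) {L : ℝ} (hL : 0 ≤ L) (hM : SpectralSqLE M L) :
    (∑ x, ∑ y, M x y * ∑ a, ∑ b, ‖ψ x y (a, 1, b)‖ ^ 2) ^ 2 ≤
      L * N ^ 4 * Fintype.card X * Fintype.card Y := by
  obtain ⟨S, _, V, W, hS, hV, hW, hψ⟩ := h
  obtain ⟨p, hpV⟩ : ∃ p : X → (S × S) × (E × E) → ℂ, ∀ x, p x = gramEntry (V 1 · x) :=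
    ⟨_, fun _ => rfl⟩
  obtain ⟨q, hqW⟩ : ∃ q : Y → (S × S) × (E × E) → ℂ, ∀ y, q y = gramEntry (W 1 · y) :=
    ⟨_, fun _ => rfl⟩
  have hprob : ∀ x y, ((∑ a, ∑ b, ‖ψ x y (a, 1, b)‖ ^ 2 : ℝ) : ℂ) =
      (r : ℂ) ^ 2 * ∑ i, p x i * q y i := by
    intro x y
    rw [hpV, hqW, ← sum_norm_sq_sum_mul_eq_gramEntry, ← Complex.ofReal_pow, ← Complex.ofReal_mul]
    simp_rw [hψ, norm_mul, mul_pow, Complex.norm_real, Real.norm_eq_abs, sq_abs, Finset.mul_sum]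
  have hp : ∑ i, ∑ x, ‖p x i‖ ^ 2 ≤ N ^ 2 * Fintype.card E * Fintype.card X := by
    simp_rw [hpV, ← hS]
    exact sum_norm_sq_gramEntry_le (hV 1)
  have hq : ∑ i, ∑ y, ‖q y i‖ ^ 2 ≤ N ^ 2 * Fintype.card E * Fintype.card Y := by
    simp_rw [hqW, ← hS]
    exact sum_norm_sq_gramEntry_le (hW 1)
  have hsum : ((∑ x, ∑ y, M x y * ∑ a, ∑ b, ‖ψ x y (a, 1, b)‖ ^ 2 : ℝ) : ℂ) =
      (r : ℂ) ^ 2 * ∑ i, ∑ x, ∑ y, (M x y : ℂ) * (p x i * q y i) := by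
    rw [Complex.ofReal_sum]
    simp_rw [Complex.ofReal_sum, Complex.ofReal_mul, hprob, Finset.mul_sum]
    symm
    rw [Finset.sum_comm]
    refine Finset.sum_congr rfl fun x _ => ?_
    rw [Finset.sum_comm]
    refine Finset.sum_congr rfl fun y _ => Finset.sum_congr rfl fun i _ => ?_
    ring
  -- The spectral bound on `M` applies to each Gram coordinate i separately; Cauchy–Schwarz then
  -- combines the coordinates.
  have hcs := norm_sum_sq_le_of_sq_le_mul Finset.univ
    (fun i => ∑ x, ∑ y, (M x y : ℂ) * (p x i * q y i))
    (p := fun i => L * ∑ x, ‖p x i‖ ^ 2) (q := fun i => ∑ y, ‖q y i‖ ^ 2)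
    (fun _ _ => by positivity) (fun _ _ => by positivity) (fun i _ => hM (p · i) (q · i))
  rw [← sq_abs, ← Real.norm_eq_abs, ← Complex.norm_real, hsum, norm_mul, mul_pow]
  rw [← Finset.mul_sum] at hcs
  have hr4 : ‖(r : ℂ) ^ 2‖ ^ 2 = r ^ 4 := by
    rw [norm_pow, Complex.norm_real, Real.norm_eq_abs, sq_abs]; ring
  rw [hr4]
  -- Each side contributes a factor |E|, and r⁴|E|² = 1 removes both.
  calc _ ≤ r ^ 4 * ((L * (N ^ 2 * Fintype.card E * Fintype.card X)) *
        (N ^ 2 * Fintype.card E * Fintype.card Y)) := by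
        refine mul_le_mul_of_nonneg_left (hcs.trans ?_) (by positivity)
        gcongr
    _ = (r ^ 2 * Fintype.card E) ^ 2 * (L * N ^ 4 * Fintype.card X * Fintype.card Y) := by ring
    _ = _ := by rw [hr]; ring

namespace EntangledProtocol

variable {X Y W E : Type} [Fintype X] [DecidableEq X] [Fintype Y] [DecidableEq Y]
  [Fintype W] [DecidableEq W] [Fintype E] [DecidableEq E]

/-- A single product term suffices because the sum over `e` is already the contraction index. The
zero matrix records that the channel never starts in |1⟩. -/
theorem hasProductForm_init (P : EntangledProtocol X Y W E) :
    HasProductForm E ((1 / Real.sqrt (Fintype.card E) : ℝ) : ℂ) 1 P.init := by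
  refine ⟨Unit, inferInstance,
    fun c _ x => if c = 0 then Matrix.of fun a e => if a = (x, P.w₀, e) then 1 else 0 else 0,
    fun _ _ y => Matrix.of fun b e => if b = (y, P.w₀, e) then 1 else 0, rfl, ?_, ?_, ?_⟩
  · intro c _ x
    dsimp only
    split_ifs
    · exact isContraction_of_injective fun e e' h => by simpa using h
    · exact isContraction_zero
  · intro _ _ y
    exact isContraction_of_injective fun e e' h => by simpa using h
  · intro x y a c b
    rw [init, Pi.smul_apply, smul_eq_mul, Finset.sum_apply]
    congr 1
    rw [Finset.sum_const, Finset.card_univ, Fintype.card_unit, one_smul]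
    refine Finset.sum_congr rfl fun e _ => ?_
    by_cases hc : c = 0 <;> by_cases ha : a = (x, P.w₀, e) <;> by_cases hb : b = (y, P.w₀, e) <;>
      simp [hc, ha, hb]

theorem hasProductForm_final (P : EntangledProtocol X Y W E) :
    HasProductForm E ((1 / Real.sqrt (Fintype.card E) : ℝ) : ℂ) (2 ^ P.cost) P.final := by
  have key : ∀ (l : List (Matrix.unitaryGroup ((X × W × E) × Fin 2) ℂ ×
      Matrix.unitaryGroup (Fin 2 × (Y × W × E)) ℂ)) (N : ℕ)
      (ψ : X → Y → (X × W × E) × Fin 2 × (Y × W × E) → ℂ) (r : ℂ), HasProductForm E r N ψ →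
      HasProductForm E r (2 ^ (2 * l.length) * N) (fun x y => l.foldl
        (fun ψ U => bobOp (X × W × E) U.2.1 *ᵥ (aliceOp (Y × W × E) U.1.1 *ᵥ ψ)) (ψ x y)) := by
    intro l
    induction l with
    | nil => intro N ψ r h; simpa using h
    | cons U l ih =>
      intro N ψ r h
      have h' := ih _ _ r ((h.aliceOp (isContraction_of_unitaryGroup U.1)).bobOp
        (isContraction_of_unitaryGroup U.2))
      have hN : 2 ^ (2 * (U :: l).length) * N = 2 ^ (2 * l.length) * (2 * (2 * N)) := by
        rw [List.length_cons]
        ring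
      rw [hN]
      exact h'
  have h := key P.rounds 1 P.init _ P.hasProductForm_init
  rw [mul_one] at h
  exact h

theorem sum_norm_sq_final_le [Nonempty E] (P : EntangledProtocol X Y W E) (x : X) (y : Y) :
    ∑ i, ‖P.final x y i‖ ^ 2 ≤ 1 := by
  have key : ∀ (l : List (Matrix.unitaryGroup ((X × W × E) × Fin 2) ℂ ×
      Matrix.unitaryGroup (Fin 2 × (Y × W × E)) ℂ))
      (ψ : (X × W × E) × Fin 2 × (Y × W × E) → ℂ),
      ∑ i, ‖(l.foldl (fun ψ U => bobOp (X × W × E) U.2.1 *ᵥ (aliceOp (Y × W × E) U.1.1 *ᵥ ψ)) ψ)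
        i‖ ^ 2 = ∑ i, ‖ψ i‖ ^ 2 := by
    intro l
    induction l with
    | nil => intro ψ; rfl
    | cons U l ih =>
      intro ψ
      rw [List.foldl_cons, ih, sum_norm_sq_bobOp_mulVec (conjTranspose_mul_self_of_unitaryGroup _),
        sum_norm_sq_aliceOp_mulVec (conjTranspose_mul_self_of_unitaryGroup _)]
  rw [final, key]
  have hinj : Function.Injective
      (fun e : E => (((x, P.w₀, e), (0 : Fin 2), (y, P.w₀, e)) :
        (X × W × E) × Fin 2 × (Y × W × E))) := fun e e' h => by simpa using h
  have hinit : P.init x y = (Matrix.of fun a e => if a = ((x, P.w₀, e), (0 : Fin 2), (y, P.w₀, e))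
      then (1 : ℂ) else 0) *ᵥ fun _ : E => ((1 / Real.sqrt (Fintype.card E) : ℝ) : ℂ) := by
    ext i
    rw [init, Pi.smul_apply, smul_eq_mul, Finset.sum_apply, Finset.mul_sum, Matrix.mulVec,
      dotProduct]
    refine Finset.sum_congr rfl fun e _ => ?_
    rw [Matrix.of_apply, Pi.single_apply, mul_comm]
  rw [hinit]
  refine (isContraction_of_injective hinj _).trans (le_of_eq ?_)
  have hE : (0 : ℝ) < Fintype.card E := by exact_mod_cast Fintype.card_pos
  rw [Finset.sum_const, Finset.card_univ, nsmul_eq_mul, Complex.norm_real, Real.norm_eq_abs,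
    sq_abs, div_pow, Real.sq_sqrt hE.le]
  field_simp

theorem acceptProb_nonneg (P : EntangledProtocol X Y W E) (x : X) (y : Y) :
    0 ≤ P.acceptProb x y := by
  unfold acceptProb
  positivity

theorem acceptProb_le_one [Nonempty E] (P : EntangledProtocol X Y W E) (x : X) (y : Y) :
    P.acceptProb x y ≤ 1 := by
  refine le_trans ?_ (P.sum_norm_sq_final_le x y)
  exact sum_norm_sq_channel_le _ 1

theorem sum_mul_acceptProb_sq_le [Nonempty E] (P : EntangledProtocol X Y W E) (M : Matrix X Y ℝ)
    {L : ℝ} (hL : 0 ≤ L) (hM : SpectralSqLE M L) :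
    (∑ x, ∑ y, M x y * P.acceptProb x y) ^ 2 ≤
      L * 16 ^ P.cost * Fintype.card X * Fintype.card Y := by
  have hr : (1 / Real.sqrt (Fintype.card E)) ^ 2 * (Fintype.card E : ℝ) = 1 := by
    have : (0 : ℝ) < Fintype.card E := by exact_mod_cast Fintype.card_pos
    rw [div_pow, Real.sq_sqrt this.le]
    field_simp
  refine (P.hasProductForm_final.sum_mul_sq_le hr M hL hM).trans (le_of_eq ?_)
  push_cast
  rw [← pow_mul, mul_comm P.cost 4, pow_mul]
  norm_num

/-- The expected sign of the output is 1 - 2·`acceptProb`, and a wrong output shifts it by 2. -/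
theorem Computes.abs_sub_le [Nonempty E] {P : EntangledProtocol X Y W E} {F : Matrix X Y ℝ} {δ : ℝ}
    (h : P.Computes F δ) {x : X} {y : Y} (hF : F x y = 1 ∨ F x y = -1) :
    |F x y - (1 - 2 * P.acceptProb x y)| ≤ 2 * δ := by
  have h0 := P.acceptProb_nonneg x y
  have h1 := P.acceptProb_le_one x y
  have h2 := h x y
  rw [Fin.sum_univ_two] at h2
  rcases hF with hF | hF <;> norm_num [hF, outputProb] at h2 <;> rw [hF, abs_le] <;>
    constructor <;> linarith

end EntangledProtocol

/-! ### Approximate degree and its dual characterisation -/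

theorem totalDegree_prod_one_sub_two_mul_X_le {t : ℕ} (S : Finset (Fin t)) :
    (∏ i ∈ S, (1 - MvPolynomial.C 2 * MvPolynomial.X i : MvPolynomial (Fin t) ℝ)).totalDegree ≤
      S.card := by
  refine (MvPolynomial.totalDegree_finsetProd _ _).trans ?_
  refine (Finset.sum_le_card_nsmul _ _ 1 fun i _ => ?_).trans (by simp)
  refine (MvPolynomial.totalDegree_sub _ _).trans (max_le (by simp) ?_)
  refine (MvPolynomial.totalDegree_mul _ _).trans ?_
  simp

/-- On the cube the character of S is the polynomial ∏ (1 - 2xᵢ) over i in S, of degree at most |S|.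
-/
theorem approxDeg_le_of_walsh {t : ℕ} {ε : ℝ} {f : (Fin t → Bool) → ℝ} {d : ℕ}
    (c : Finset (Fin t) → ℝ) (hc : ∀ S, d < S.card → c S = 0)
    (h : ∀ x, |f x - ∑ S, c S * walsh S x| ≤ ε) : approxDeg ε f ≤ d := by
  refine Nat.sInf_le ⟨∑ S, MvPolynomial.C (c S) *
    ∏ i ∈ S, (1 - MvPolynomial.C 2 * MvPolynomial.X i), ?_, fun x => ?_⟩
  · refine MvPolynomial.totalDegree_finsetSum_le fun S _ => ?_
    rcases lt_or_ge d S.card with hS | hS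
    · simp [hc S hS]
    · refine (MvPolynomial.totalDegree_mul _ _).trans ?_
      rw [MvPolynomial.totalDegree_C, zero_add]
      exact (totalDegree_prod_one_sub_two_mul_X_le S).trans hS
  · convert h x using 3
    simp [walsh, boolSign_eq_one_sub]

/-- A function without a good approximation of degree less than `d` correlates with a function
whose spectrum starts at level `d`. -/
theorem exists_dual_of_not_approx {ι : Type*} [Fintype ι] [DecidableEq ι] {ε : ℝ} (hε : 0 ≤ ε)
    {f : (ι → Bool) → ℝ} {d : ℕ}
    (h : ∀ c : Finset ι → ℝ, (∀ S, d ≤ S.card → c S = 0) →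
      ¬ ∀ x, |f x - ∑ S, c S * walsh S x| ≤ ε) :
    ∃ ψ : (ι → Bool) → ℝ, ∑ x, |ψ x| = 1 ∧ ε < ∑ x, f x * ψ x ∧
      ∀ S : Finset ι, S.card < d → walshCoeff ψ S = 0 := by
  let P : Submodule ℝ ((ι → Bool) → ℝ) :=
    Submodule.span ℝ ((fun S : Finset ι => (walsh S : (ι → Bool) → ℝ)) '' {S | S.card < d})
  have hdisj : Disjoint (Metric.closedBall f ε) (P : Set ((ι → Bool) → ℝ)) := by
    rw [Set.disjoint_left]
    intro g hg hgP
    obtain ⟨c, hc⟩ : ∃ c : Finset ι → ℝ, (∀ S, d ≤ S.card → c S = 0) ∧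
        ∀ x, g x = ∑ S, c S * walsh S x := by
      refine Submodule.span_induction (p := fun g _ => ∃ c : Finset ι → ℝ,
        (∀ S, d ≤ S.card → c S = 0) ∧ ∀ x, g x = ∑ S, c S * walsh S x) ?_ ?_ ?_ ?_ hgP
      · rintro _ ⟨S, hS, rfl⟩
        refine ⟨Pi.single S 1, fun T hT => ?_, fun x => ?_⟩
        · exact Pi.single_eq_of_ne (fun h => absurd hS (by simp [← h, hT])) _
        · simp [Pi.single_apply]
      · exact ⟨0, by simp, by simp⟩
      · rintro g g' _ _ ⟨c, hc, hg⟩ ⟨c', hc', hg'⟩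
        refine ⟨c + c', fun S hS => by simp [hc S hS, hc' S hS], fun x => ?_⟩
        simp [hg, hg', add_mul, Finset.sum_add_distrib]
      · rintro a g _ ⟨c, hc, hg⟩
        refine ⟨a • c, fun S hS => by simp [hc S hS], fun x => ?_⟩
        simp [hg, Finset.mul_sum, mul_assoc]
    refine h c hc.1 fun x => ?_
    rw [← hc.2, ← Real.dist_eq, dist_comm]
    exact (dist_le_pi_dist g f x).trans (Metric.mem_closedBall.1 hg)
  -- The functional satisfies φ < a < b on the ball and φ > b on the subspace.
  obtain ⟨φ, a, b, ha, hab, hb⟩ := geometric_hahn_banach_compact_closed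
    (convex_closedBall f ε) (isCompact_closedBall f ε) P.convex P.closed_of_finiteDimensional hdisj
  have hb0 : b < 0 := by simpa using hb 0 P.zero_mem
  have hP : ∀ g ∈ P, φ g = 0 := by
    intro g hg
    by_contra hne
    -- If φ g ≠ 0, this multiple of g takes the forbidden value b.
    have := hb ((b / φ g) • g) (P.smul_mem _ hg)
    rw [map_smul, smul_eq_mul, div_mul_cancel₀ _ hne] at this
    exact lt_irrefl _ this
  have hφ : ∀ g : (ι → Bool) → ℝ, φ g = ∑ x, g x * φ (Pi.single x 1) := by
    intro g
    conv_lhs => rw [pi_eq_sum_univ' g, map_sum]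
    refine Finset.sum_congr rfl fun x _ => ?_
    rw [map_smul, smul_eq_mul]
  set m : (ι → Bool) → ℝ := fun x => φ (Pi.single x 1)
  have hmain : ∑ x, f x * m x + ε * ∑ x, |m x| < 0 := by
    -- The point of the ball that maximizes φ; its value is ⟨f,m⟩ + ε‖m‖₁.
    have hmem : (fun x => f x + ε * SignType.sign (m x)) ∈ Metric.closedBall f ε := by
      rw [Metric.mem_closedBall, dist_pi_le_iff hε]
      intro x
      rw [Real.dist_eq, add_sub_cancel_left, abs_mul, abs_of_nonneg hε]
      refine mul_le_of_le_one_right hε ?_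
      rcases lt_trichotomy (m x) 0 with h | h | h <;> simp [h]
    have := (ha _ hmem).trans (hab.trans hb0)
    rw [hφ] at this
    refine lt_of_eq_of_lt ?_ this
    rw [Finset.mul_sum, ← Finset.sum_add_distrib]
    refine Finset.sum_congr rfl fun x _ => ?_
    rw [add_mul, mul_assoc, sign_mul_self]
  have hm0 : 0 ≤ ∑ x, |m x| := by positivity
  have hmpos : 0 < ∑ x, |m x| := by
    refine hm0.lt_of_ne fun h0 => ?_
    have : ∀ x, m x = 0 := fun x =>
      abs_eq_zero.1 ((Finset.sum_eq_zero_iff_of_nonneg fun _ _ => abs_nonneg _).1 h0.symm x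
        (Finset.mem_univ x))
    simp [this] at hmain
  -- The witness is `m` normalized in ℓ¹, with its sign flipped because φ is negative on the ball.
  refine ⟨fun x => -(∑ x, |m x|)⁻¹ * m x, ?_, ?_, fun S hS => ?_⟩
  · simp_rw [abs_mul, abs_neg, abs_inv, abs_of_pos hmpos, ← Finset.mul_sum]
    exact inv_mul_cancel₀ hmpos.ne'
  · have : ∑ x, f x * (-(∑ x, |m x|)⁻¹ * m x) = -(∑ x, f x * m x) / ∑ x, |m x| := by
      rw [neg_div, div_eq_mul_inv, Finset.sum_mul, ← Finset.sum_neg_distrib]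
      exact Finset.sum_congr rfl fun x _ => by ring
    rw [this, lt_div_iff₀ hmpos]
    linarith
  · have h0 := hP _ (Submodule.subset_span ⟨S, hS, rfl⟩)
    rw [hφ] at h0
    rw [walshCoeff]
    have : ∀ x, -(∑ x, |m x|)⁻¹ * m x * walsh S x = -(∑ x, |m x|)⁻¹ * (walsh S x * m x) :=
      fun x => by ring
    simp_rw [this, ← Finset.mul_sum]
    rw [h0, mul_zero, mul_zero]

theorem exists_dual_of_approxDeg {t : ℕ} {ε : ℝ} (hε0 : 0 ≤ ε) (hε1 : ε < 1)
    {f : (Fin t → Bool) → ℝ} (hf : ∀ z, f z = 1 ∨ f z = -1) :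
    ∃ ψ : (Fin t → Bool) → ℝ, ∑ x, |ψ x| = 1 ∧ ε < ∑ x, f x * ψ x ∧
      ∀ S : Finset (Fin t), S.card < approxDeg ε f → walshCoeff ψ S = 0 := by
  refine exists_dual_of_not_approx hε0 fun c hc happ => ?_
  -- Degree 0 is separate because d - 1 would truncate. In that case the approximant is identically
  -- 0, which is at distance 1 > ε from a sign.
  rcases Nat.eq_zero_or_pos (approxDeg ε f) with h0 | hpos
  · have := happ fun _ => false
    simp only [hc _ (h0.le.trans (Nat.zero_le _)), zero_mul, Finset.sum_const_zero, sub_zero] at this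
    rcases hf fun _ => false with h | h <;> rw [h] at this <;> norm_num at this <;> linarith
  · have := approxDeg_le_of_walsh (d := approxDeg ε f - 1) c (fun S hS => hc S (by omega)) happ
    omega

/-! ### Pattern sets -/

namespace PatternSet

/-- The element of `V` in the `j`-th block. -/
def elem {n t : ℕ} (h : t ∣ n) (V : PatternSet n t) (j : Fin t) : Fin n :=
  V.1.orderEmbOfFin (V.card_eq h) j

theorem elem_injective {n t : ℕ} (h : t ∣ n) (V : PatternSet n t) :
    Function.Injective (V.elem h) :=
  (V.1.orderEmbOfFin (V.card_eq h)).injective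

theorem image_elem {n t : ℕ} (h : t ∣ n) (V : PatternSet n t) :
    Finset.univ.image (V.elem h) = V.1 := by
  apply Finset.coe_injective
  rw [Finset.coe_image, Finset.coe_univ, Set.image_univ]
  exact Finset.range_orderEmbOfFin _ _

/-- The j-th smallest element of V lies in the j-th block: the block index increases weakly along
the enumeration and never repeats, since a block meets V only once, and a strictly increasing
self-map of `Fin t` onto itself is the identity. -/
theorem elem_div {n t : ℕ} (hn : 0 < n) (h : t ∣ n) (V : PatternSet n t) (j : Fin t) :
    (V.elem h j : ℕ) / (n / t) = j := by
  have ht : 0 < t := Nat.pos_of_dvd_of_pos h hn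
  have hm : 0 < n / t := Nat.div_pos (Nat.le_of_dvd hn h) ht
  have hlt : ∀ i : Fin n, (i : ℕ) / (n / t) < t := fun i => by
    rw [Nat.div_lt_iff_lt_mul hm, mul_comm, Nat.div_mul_cancel h]
    exact i.2
  let b : Fin t → Fin t := fun j => ⟨(V.elem h j : ℕ) / (n / t), hlt _⟩
  have hb : StrictMono b := by
    refine Monotone.strictMono_of_injective (fun j k hjk => ?_) fun j k hjk => ?_
    · exact Nat.div_le_div_right ((V.1.orderEmbOfFin (V.card_eq h)).monotone hjk)
    · have hjk' : (V.elem h j : ℕ) / (n / t) = (V.elem h k : ℕ) / (n / t) :=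
        congrArg Fin.val hjk
      obtain ⟨e, he⟩ := Finset.card_eq_one.1 (V.2 (b j))
      have mem : ∀ l, b l = b j → V.elem h l ∈ V.1 ∩ patternBlock n t (b j) := by
        intro l hl
        rw [Finset.mem_inter, patternBlock, Finset.mem_filter, ← hl]
        refine ⟨Finset.orderEmbOfFin_mem _ _ _, Finset.mem_univ _, Nat.div_mul_le_self _ _, ?_⟩
        exact (Nat.div_lt_iff_lt_mul hm).1 (Nat.lt_succ_self _)
      have h1 := mem j rfl
      have h2 := mem k hjk.symm
      rw [he, Finset.mem_singleton] at h1 h2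
      exact V.elem_injective h (h1.trans h2.symm)
  have hid : b = id := by
    have : Set.range b = Set.range (id : Fin t → Fin t) := by
      rw [Set.range_id, Set.range_eq_univ]
      exact Finite.surjective_of_injective hb.injective
    exact (StrictMono.range_inj hb strictMono_id).1 this
  exact congrArg Fin.val (congrFun hid j)

/-- The blocks met by T determine S, and T determines V on those blocks. Only the positions of V in
the other t - |S| blocks remain free, with n/t choices each. -/
theorem card_filter_image_elem_mul_pow_le {n t : ℕ} (hn : 0 < n) (h : t ∣ n) (d : ℕ)
    (T : Finset (Fin n)) :
    ((Finset.univ : Finset (Finset (Fin t) × PatternSet n t)).filter fun p =>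
      d ≤ p.1.card ∧ p.1.image (p.2.elem h) = T).card * (n / t) ^ d ≤ (n / t) ^ t := by
  have ht : 0 < t := Nat.pos_of_dvd_of_pos h hn
  have hm : 0 < n / t := Nat.div_pos (Nat.le_of_dvd hn h) ht
  set A := (Finset.univ : Finset (Finset (Fin t) × PatternSet n t)).filter fun p =>
      d ≤ p.1.card ∧ p.1.image (p.2.elem h) = T with hA
  rcases A.eq_empty_or_nonempty with h0 | ⟨p₀, hp₀⟩
  · simp [h0]
  have agree : ∀ p ∈ A, p.1 = p₀.1 ∧ ∀ j ∈ p₀.1, p.2.elem h j = p₀.2.elem h j := by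
    have step : ∀ p ∈ A, ∀ q ∈ A, ∀ j ∈ p.1, j ∈ q.1 ∧ p.2.elem h j = q.2.elem h j := by
      intro p hp q hq j hj
      have hjT : p.2.elem h j ∈ q.1.image (q.2.elem h) := by
        rw [(Finset.mem_filter.1 hq).2.2, ← (Finset.mem_filter.1 hp).2.2]
        exact Finset.mem_image_of_mem _ hj
      obtain ⟨k, hk, hkj⟩ := Finset.mem_image.1 hjT
      have : k = j := by
        rw [Fin.ext_iff, ← q.2.elem_div hn h k, hkj, p.2.elem_div hn h j]
      subst this
      exact ⟨hk, hkj.symm⟩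
    intro p hp
    refine ⟨Finset.Subset.antisymm (fun j hj => (step p hp p₀ hp₀ j hj).1)
      fun j hj => (step p₀ hp₀ p hp j hj).1, fun j hj => ?_⟩
    exact (step p₀ hp₀ p hp j hj).2.symm
  have hcard : A.card ≤ (n / t) ^ (t - p₀.1.card) := by
    let g : Finset (Fin t) × PatternSet n t → ({j // j ∈ p₀.1ᶜ} → Fin (n / t)) :=
      fun p j => ⟨(p.2.elem h j : ℕ) % (n / t), Nat.mod_lt _ hm⟩
    have hg : Set.InjOn g A := by
      intro p hp q hq hpq
      have helem : ∀ j, p.2.elem h j = q.2.elem h j := by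
        intro j
        by_cases hj : j ∈ p₀.1
        · rw [(agree p hp).2 j hj, (agree q hq).2 j hj]
        · have hmod : (p.2.elem h j : ℕ) % (n / t) = (q.2.elem h j : ℕ) % (n / t) :=
            congrArg Fin.val (congrFun hpq ⟨j, Finset.mem_compl.2 hj⟩)
          rw [Fin.ext_iff, ← Nat.div_add_mod (p.2.elem h j : ℕ) (n / t), hmod,
            p.2.elem_div hn h, ← q.2.elem_div hn h j, Nat.div_add_mod]
      refine Prod.ext ((agree p hp).1.trans (agree q hq).1.symm) (Subtype.ext ?_)
      rw [← image_elem h p.2, ← image_elem h q.2, funext helem]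
    calc A.card = (A.image g).card := (Finset.card_image_of_injOn hg).symm
      _ ≤ Fintype.card ({j // j ∈ p₀.1ᶜ} → Fin (n / t)) := Finset.card_le_univ _
      _ = _ := by simp
  have hle : p₀.1.card ≤ t := by simpa using Finset.card_le_univ p₀.1
  calc _ ≤ (n / t) ^ (t - p₀.1.card) * (n / t) ^ p₀.1.card := by
        gcongr
        exact (Finset.mem_filter.1 hp₀).2.1
    _ = _ := by rw [← pow_add, Nat.sub_add_cancel hle]

/-- Any choice of an offset in each block gives a member of the family. Only this inequality is
needed, because the count G ends up in a denominator. -/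
theorem pow_le_card {n t : ℕ} (hn : 0 < n) (h : t ∣ n) :
    (n / t) ^ t ≤ Fintype.card (PatternSet n t) := by
  have ht : 0 < t := Nat.pos_of_dvd_of_pos h hn
  have hm : 0 < n / t := Nat.div_pos (Nat.le_of_dvd hn h) ht
  let pos : (Fin t → Fin (n / t)) → Fin t → Fin n := fun g j =>
    ⟨(j : ℕ) * (n / t) + g j, by
      calc (j : ℕ) * (n / t) + g j < (j : ℕ) * (n / t) + n / t := by
            exact Nat.add_lt_add_left (g j).2 _
        _ = (j + 1) * (n / t) := by ring
        _ ≤ t * (n / t) := Nat.mul_le_mul_right _ j.2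
        _ = n := Nat.mul_div_cancel' h⟩
  have hdiv : ∀ g j, (pos g j : ℕ) / (n / t) = j := fun g j => by
    change ((j : ℕ) * (n / t) + g j) / (n / t) = j
    rw [mul_comm, Nat.mul_add_div hm, Nat.div_eq_of_lt (g j).2, add_zero]
  have hblock : ∀ g j k, pos g k ∈ patternBlock n t j ↔ k = j := fun g j k => by
    rw [patternBlock, Finset.mem_filter, Fin.ext_iff, ← hdiv g k, Nat.div_eq_iff hm]
    simp only [Finset.mem_univ, true_and]
    have := add_mul (j : ℕ) 1 (n / t)
    omega
  have hcard : ∀ g j, (Finset.univ.image (pos g) ∩ patternBlock n t j).card = 1 := fun g j => by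
    rw [Finset.card_eq_one]
    refine ⟨pos g j, ?_⟩
    ext i
    rw [Finset.mem_inter, Finset.mem_image, Finset.mem_singleton]
    constructor
    · rintro ⟨⟨k, _, rfl⟩, hk⟩
      rw [(hblock g j k).1 hk]
    · rintro rfl
      exact ⟨⟨j, Finset.mem_univ _, rfl⟩, (hblock g j j).2 rfl⟩
  let F : (Fin t → Fin (n / t)) → PatternSet n t := fun g => ⟨Finset.univ.image (pos g), hcard g⟩
  have hF : Function.Injective F := by
    intro g g' hgg
    funext j
    have himg : Finset.univ.image (pos g) = Finset.univ.image (pos g') := congrArg Subtype.val hgg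
    have hmem : pos g j ∈ Finset.univ.image (pos g') := by
      rw [← himg]
      exact Finset.mem_image_of_mem _ (Finset.mem_univ j)
    obtain ⟨k, _, hk⟩ := Finset.mem_image.1 hmem
    have hkj : k = j := by
      rw [Fin.ext_iff, ← hdiv g' k, hk, hdiv g j]
    subst hkj
    have : (k : ℕ) * (n / t) + g' k = (k : ℕ) * (n / t) + g k := congrArg Fin.val hk
    exact Fin.ext (by omega)
  simpa using Fintype.card_le_of_injective F hF

end PatternSet

/-! ### Pattern matrices -/

/-- For fixed x and V, the map w ↦ x|_V ⊕ w is a bijection of the cube. -/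
theorem sum_sum_patternMatrix {n t : ℕ} (h : t ∣ n) (φ : (Fin t → Bool) → ℝ) :
    ∑ x, ∑ y, patternMatrix n t h φ x y =
      2 ^ n * Fintype.card (PatternSet n t) * ∑ z, φ z := by
  have hx : ∀ x : Fin t → Bool, ∑ w : Fin t → Bool, φ (fun j => xor (x j) (w j)) = ∑ z, φ z := by
    intro x
    have hinv : Function.Involutive fun (w : Fin t → Bool) j => xor (x j) (w j) := fun w => by
      funext j
      simp
    exact Equiv.sum_comp hinv.toPerm φ
  simp only [patternMatrix, Matrix.of_apply, Fintype.sum_prod_type, hx]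
  simp [mul_assoc]

theorem spectralSqLE_patternMatrix {n t : ℕ} (hn : 0 < n) (h : t ∣ n) {ψ : (Fin t → Bool) → ℝ}
    (hψ : ∑ z, |ψ z| = 1) {d : ℕ} (hd : ∀ S : Finset (Fin t), S.card < d → walshCoeff ψ S = 0) :
    SpectralSqLE (patternMatrix n t h ψ)
      (((2 : ℝ) ^ t)⁻¹ ^ 2 * (((n / t : ℕ) : ℝ) ^ t / ((n / t : ℕ) : ℝ) ^ d) * 2 ^ n * 2 ^ t) := by
  have hm : 0 < n / t := Nat.div_pos (Nat.le_of_dvd hn h) (Nat.pos_of_dvd_of_pos h hn)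
  have key := spectralSqLE_of_fibre_card_le (fun V : PatternSet n t => V.elem h)
    (fun V => V.elem_injective h) ψ d (c := ((2 : ℝ) ^ t)⁻¹ ^ 2)
    (N := ((n / t : ℕ) : ℝ) ^ t / ((n / t : ℕ) : ℝ) ^ d) hd (by positivity) (fun S => ?_)
    (fun T => ?_)
  · rw [Fintype.card_fin, Fintype.card_fin] at key
    exact key
  · rw [← sq_abs]
    gcongr
    simpa [hψ] using abs_walshCoeff_le ψ S
  · rw [le_div_iff₀ (by positivity)]
    exact_mod_cast PatternSet.card_filter_image_elem_mul_pow_le hn h d T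

theorem pow_mul_sq_le_of_computes {n t : ℕ} (hn : 0 < n) (h : t ∣ n) {f : (Fin t → Bool) → ℝ}
    (hf : ∀ z, f z = 1 ∨ f z = -1) {ε δ : ℝ} (hε0 : 0 ≤ ε) (hε1 : ε < 1) (hδ : δ < ε / 2)
    {W E : Type} [Fintype W] [DecidableEq W] [Fintype E] [DecidableEq E] [Nonempty E]
    (P : EntangledProtocol (Fin n → Bool) (PatternSet n t × (Fin t → Bool)) W E)
    (hP : P.Computes (patternMatrix n t h f) δ) :
    ((n / t : ℕ) : ℝ) ^ approxDeg ε f * (ε - 2 * δ) ^ 2 ≤ 9 * 16 ^ P.cost := by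
  obtain ⟨ψ, hψ1, hψε, hψd⟩ := exists_dual_of_approxDeg hε0 hε1 hf
  have hm : 0 < n / t := Nat.div_pos (Nat.le_of_dvd hn h) (Nat.pos_of_dvd_of_pos h hn)
  have hspec := spectralSqLE_patternMatrix hn h hψ1 hψd
  set d := approxDeg ε f
  set m : ℝ := ((n / t : ℕ) : ℝ)
  set L : ℝ := ((2 : ℝ) ^ t)⁻¹ ^ 2 * (m ^ t / m ^ d) * 2 ^ n * 2 ^ t with hL
  set Ψ := patternMatrix n t h ψ
  set F := patternMatrix n t h f
  have hm0 : 0 < m := Nat.cast_pos.2 hm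
  set G : ℝ := (Fintype.card (PatternSet n t) : ℝ) with hG
  have hGm : m ^ t ≤ G := by
    rw [← Nat.cast_pow]
    exact Nat.cast_le.2 (PatternSet.pow_le_card hn h)
  have hG0 : 0 < G := (by positivity : 0 < m ^ t).trans_le hGm
  have hL0 : 0 ≤ L := by positivity
  -- The entrywise product of two pattern matrices is the pattern matrix of the product function.
  have hFψ : ∑ x, ∑ y, F x y * Ψ x y = 2 ^ n * G * ∑ z, f z * ψ z :=
    sum_sum_patternMatrix h fun z => f z * ψ z
  have hΨ1 : ∑ x, ∑ y, |Ψ x y| = 2 ^ n * G := by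
    have := sum_sum_patternMatrix h fun z => |ψ z|
    rw [hψ1, mul_one] at this
    exact this
  set R : ℝ := Real.sqrt (L * Fintype.card (Fin n → Bool) *
    Fintype.card (PatternSet n t × (Fin t → Bool))) with hR
  have hJ : |∑ x, ∑ y, Ψ x y| ≤ R := Real.abs_le_sqrt hspec.sum_sq_le
  have hA : |∑ x, ∑ y, Ψ x y * P.acceptProb x y| ≤ 4 ^ P.cost * R := by
    refine abs_le_of_sq_le_sq ((P.sum_mul_acceptProb_sq_le Ψ hL0 hspec).trans (le_of_eq ?_))
      (by positivity)
    rw [mul_pow, hR, Real.sq_sqrt (by positivity), ← pow_mul, mul_comm P.cost 2, pow_mul]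
    norm_num
    ring
  have hdiff : ∑ x, ∑ y, (F x y - (1 - 2 * P.acceptProb x y)) * Ψ x y ≤ 2 * δ * (2 ^ n * G) := by
    rw [← hΨ1, Finset.mul_sum]
    refine Finset.sum_le_sum fun x _ => ?_
    rw [Finset.mul_sum]
    refine Finset.sum_le_sum fun y _ => ?_
    refine (le_abs_self _).trans ?_
    rw [abs_mul]
    exact mul_le_mul_of_nonneg_right (hP.abs_sub_le (hf _)) (abs_nonneg _)
  have hsplit : ∑ x, ∑ y, F x y * Ψ x y =
      ∑ x, ∑ y, (F x y - (1 - 2 * P.acceptProb x y)) * Ψ x y + ∑ x, ∑ y, Ψ x y -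
        2 * ∑ x, ∑ y, Ψ x y * P.acceptProb x y := by
    simp_rw [Finset.mul_sum, ← Finset.sum_add_distrib, ← Finset.sum_sub_distrib]
    refine Finset.sum_congr rfl fun x _ => Finset.sum_congr rfl fun y _ => ?_
    ring
  -- The constant 3 comes from J - 2Π: J contributes `R`, 2Π contributes 2·4^c·R, and R ≤ 4^c·R.
  have h1 : (ε - 2 * δ) * (2 ^ n * G) ≤ 3 * 4 ^ P.cost * R := by
    have hR0 : 0 ≤ R := Real.sqrt_nonneg _
    have h4 : (1 : ℝ) ≤ 4 ^ P.cost := one_le_pow₀ (by norm_num)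
    have h5 : 1 * R ≤ 4 ^ P.cost * R := mul_le_mul_of_nonneg_right h4 hR0
    have h6 : ε * (2 ^ n * G) ≤ ∑ x, ∑ y, F x y * Ψ x y := by
      rw [hFψ, mul_comm]
      exact mul_le_mul_of_nonneg_left hψε.le (by positivity)
    have h7 := (abs_le.1 hJ).2
    have h8 := (abs_le.1 hA).1
    linarith
  have hR2 : R ^ 2 = (2 ^ n * G) ^ 2 * (m ^ t / G) / m ^ d := by
    rw [hR, Real.sq_sqrt (by positivity), hL]
    simp only [Fintype.card_prod, Fintype.card_fun, Fintype.card_fin, Fintype.card_bool]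
    push_cast
    rw [← hG]
    field_simp
  have h2 := pow_le_pow_left₀ (mul_nonneg (by linarith) (by positivity)) h1 2
  rw [mul_pow, mul_pow (3 * 4 ^ P.cost), hR2] at h2
  have h16 : ((3 : ℝ) * 4 ^ P.cost) ^ 2 = 9 * 16 ^ P.cost := by
    rw [mul_pow, ← pow_mul, mul_comm P.cost 2, pow_mul]
    norm_num
  rw [h16] at h2
  have h3 : (ε - 2 * δ) ^ 2 * (2 ^ n * G) ^ 2 ≤ 9 * 16 ^ P.cost / m ^ d * (2 ^ n * G) ^ 2 := by
    refine h2.trans ?_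
    have : m ^ t / G ≤ 1 := (div_le_one hG0).2 hGm
    calc _ ≤ 9 * 16 ^ P.cost * ((2 ^ n * G) ^ 2 * 1 / m ^ d) := by gcongr
      _ = _ := by ring
  have h4 := le_of_mul_le_mul_right h3 (by positivity)
  rw [le_div_iff₀ (by positivity)] at h4
  linarith

theorem le_cost_of_computes {n t : ℕ} (hn : 0 < n) (h : t ∣ n) {f : (Fin t → Bool) → ℝ}
    (hf : ∀ z, f z = 1 ∨ f z = -1) {ε δ : ℝ} (hε0 : 0 ≤ ε) (hε1 : ε < 1) (hδ : δ < ε / 2)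
    {W E : Type} [Fintype W] [DecidableEq W] [Fintype E] [DecidableEq E] [Nonempty E]
    (P : EntangledProtocol (Fin n → Bool) (PatternSet n t × (Fin t → Bool)) W E)
    (hP : P.Computes (patternMatrix n t h f) δ) :
    1 / 4 * (approxDeg ε f : ℝ) * Real.logb 2 ((n : ℝ) / (t : ℝ))
      - 1 / 2 * Real.logb 2 (3 / (ε - 2 * δ)) ≤ P.cost := by
  have ht : 0 < t := Nat.pos_of_dvd_of_pos h hn
  have hm : 0 < n / t := Nat.div_pos (Nat.le_of_dvd hn h) ht
  have key := pow_mul_sq_le_of_computes hn h hf hε0 hε1 hδ P hP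
  rw [Nat.cast_div h (by positivity)] at key
  have hm0 : 0 < (n : ℝ) / t := by positivity
  have he : 0 < ε - 2 * δ := by linarith
  have hlog := Real.logb_le_logb_of_le one_lt_two (by positivity) key
  rw [Real.logb_mul (by positivity) (by positivity), Real.logb_mul (by positivity) (by positivity),
    Real.logb_pow, Real.logb_pow, Real.logb_pow, show (9 : ℝ) = 3 ^ 2 by norm_num,
    show (16 : ℝ) = 2 ^ 4 by norm_num, Real.logb_pow, Real.logb_pow,
    Real.logb_self_eq_one one_lt_two] at hlog
  rw [Real.logb_div (by norm_num) he.ne']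
  push_cast at hlog
  linarith

/-- The comparison takes place in `EReal` because the lower bound may be negative and the complexity
may be `⊤`. A finite complexity is attained by some protocol. -/
theorem le_entangledQuantumCC {X Y : Type} [Fintype X] [DecidableEq X] [Fintype Y]
    [DecidableEq Y] {δ : ℝ} {F : Matrix X Y ℝ} {r : ℝ}
    (h : ∀ (W E : Type) [Fintype W] [DecidableEq W] [Fintype E] [DecidableEq E] [Nonempty E]
      (P : EntangledProtocol X Y W E), P.Computes F δ → r ≤ P.cost) :
    (r : EReal) ≤ (((entangledQuantumCC δ F : ℕ∞) : ENNReal) : EReal) := by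
  rcases Set.eq_empty_or_nonempty {c : ℕ∞ | ∃ (W E : Type) (_ : Fintype W) (_ : DecidableEq W)
    (_ : Fintype E) (_ : DecidableEq E) (_ : Nonempty E) (P : EntangledProtocol X Y W E),
    P.Computes F δ ∧ c = P.cost} with h0 | hne
  · rw [entangledQuantumCC, h0]
    simp
  · obtain ⟨W, E, _, _, _, _, _, P, hP, hc⟩ := csInf_mem hne
    rw [entangledQuantumCC, hc]
    rw [ENat.toENNReal_coe, ← ENNReal.ofReal_natCast, EReal.coe_ennreal_ofReal,
      max_eq_left (Nat.cast_nonneg _)]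
    exact EReal.coe_le_coe_iff.2 (h W E P hP)

theorem theorem1p1 (n t : ℕ) (ht : 0 < t) (htn : t < n) (hdvd : t ∣ n)
    (f : (Fin t → Bool) → ℝ) (hf : ∀ z, f z = 1 ∨ f z = -1) :
    (∀ ε : ℝ, 0 ≤ ε → ε < 1 → ∀ δ : ℝ, δ < ε / 2 →
      ((1 / 4 * (approxDeg ε f : ℝ) * Real.logb 2 ((n : ℝ) / (t : ℝ))
          - 1 / 2 * Real.logb 2 (3 / (ε - 2 * δ)) : ℝ) : EReal)
        ≤ (((entangledQuantumCC δ (patternMatrix n t hdvd f) : ℕ∞) : ENNReal) : EReal)) ∧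
    ((1 / 4 * (approxDeg (1 / 3) f : ℝ) * Real.logb 2 ((n : ℝ) / (t : ℝ)) - 3 : ℝ) : EReal)
      < (((entangledQuantumCC (1 / 7) (patternMatrix n t hdvd f) : ℕ∞) : ENNReal) : EReal) := by
  have main : ∀ ε : ℝ, 0 ≤ ε → ε < 1 → ∀ δ : ℝ, δ < ε / 2 →
      ((1 / 4 * (approxDeg ε f : ℝ) * Real.logb 2 ((n : ℝ) / (t : ℝ))
          - 1 / 2 * Real.logb 2 (3 / (ε - 2 * δ)) : ℝ) : EReal)
        ≤ (((entangledQuantumCC δ (patternMatrix n t hdvd f) : ℕ∞) : ENNReal) : EReal) :=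
    fun ε hε0 hε1 δ hδ => le_entangledQuantumCC fun W E _ _ _ _ _ P hP =>
      le_cost_of_computes (ht.trans htn) hdvd hf hε0 hε1 hδ P hP
  refine ⟨main, lt_of_lt_of_le (EReal.coe_lt_coe_iff.2 ?_)
    (main (1 / 3) (by norm_num) (by norm_num) (1 / 7) (by norm_num))⟩
  -- Here 1/3 - 2/7 = 1/21, so the argument is 63 < 2⁶, which makes the final inequality strict.
  have h63 : Real.logb 2 (3 / (1 / 3 - 2 * (1 / 7))) < 6 := by
    rw [Real.logb_lt_iff_lt_rpow one_lt_two (by norm_num)]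
    norm_num
  linarith
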